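/- Formulas are the propositional unimodal formulas over countably many variables $p_0,p_1,\dots$; a formula is non-iterative if it has modal degree at most $1$. A normal logic is a set of formulas that contains all propositional tautologies and all instances of $\square(\varphi\to\psi)\to(\square\varphi\to\square\psi)$ and is closed under modus ponens, necessitation and uniform substitution (the set of all formulas is allowed); the logic axiomatized by a set $\Gamma$ of formulas is the least normal logic that contains $\Gamma$. For $v\ge 0$ let $n=2^v$, let $m_0,\dots,m_{n-1}$ be the conjunctions that contain each of $p_0,\dots,p_{v-1}$ exactly once, negated or not, with $m_{n-1}=p_0\wedge\dots\wedge p_{v-1}$, and for $\varepsilon\in\{0,1\}^n$ let $\chi(\varepsilon)$ be the number of $i$ with $\varepsilon_i=1$ and $\mu_\varepsilon$ the conjunction of $m_{n-1}$, of all $\lozenge m_i$ with $\varepsilon_i=1$ and of all $\neg\lozenge m_i$ with $\varepsilon_i=0$. For integers $0\le a\le n-1$, $-1\le b\le n-1$ with $a\le b+1$ put $$\alpha^{v}_{K}(a,b)= m_{n-1}\to\Bigl(\bigvee_{\chi(\varepsilon)\le a,\ \varepsilon_{n-1}=0}\mu_\varepsilon\ \vee\bigvee_{\chi(\varepsilon)\le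 b+1,\ \varepsilon_{n-1}=1}\mu_\varepsilon\Bigr),\qquad \alpha^{v}_{D}(a,b)=\lozenge\top\wedge\alpha^{v}_{K}(a,b).$$ Let $*$ be a symbol larger than all integers. The position of $(v,a,b)$ is $(a,b)$ if $b\le n-2$, it is $(a,*)$ if $a\le n-2$ and $b=n-1$, and it is $(*,*)$ if $a=b=n-1$. The positions that occur are the pairs $(x,y)$ with $x\in\mathbb{N}\cup\{*\}$, $y\in\{-1\}\cup\mathbb{N}\cup\{*\}$ and $x\le y+1$ (where $*+1=*$). For such a position let $\mathbf{S_K}(x,y)$ and $\mathbf{S_D}(x,y)$ be the normal logics axiomatized by $\alpha^{v}_{K}(a,b)$ and by $\alpha^{v}_{D}(a,b)$, where $v$ is least such that some $(v,a,b)$ has position $(x,y)$ (then $a$ and $b$ are determined). Corollary 12. (1) A normal logic that is not finitely axiomatizable cannot be axiomatized by any (necessarily countable) set of non-iterative formulas. (2) A normal logic can be axiomatized by a set of non-iterative formulas if and only if it is $\mathbf{S_K}(x,y)$ or $\mathbf{S_D}(x,y)$ for some position $(x,y)$. (3) All the logics $\mathbf{S_K}(x,y)$ and $\mathbf{S_D}(x,y)$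 are finitely axiomatizable. (4) They do not depend on the choice of the context: whenever $(v,a,b)$ has position $(x,y)$, the formulas $\alpha^{v}_{K}(a,b)$ and $\alpha^{v}_{D}(a,b)$ axiomatize $\mathbf{S_K}(x,y)$ and $\mathbf{S_D}(x,y)$ respectively. -/

import Mathlib

/-- Unimodal propositional formulas over the countably many variables `p₀, p₁, …`.
The remaining connectives are the usual abbreviations. -/
inductive ModalFormula : Type where
  | var : ℕ → ModalFormula
  | bot : ModalFormula
  | imp : ModalFormula → ModalFormula → ModalFormula
  | box : ModalFormula → ModalFormula

namespace ModalFormula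

def neg (φ : ModalFormula) : ModalFormula := imp φ bot

def top : ModalFormula := neg bot

def disj (φ ψ : ModalFormula) : ModalFormula := imp (neg φ) ψ

def conj (φ ψ : ModalFormula) : ModalFormula := neg (imp φ (neg ψ))

def dia (φ : ModalFormula) : ModalFormula := neg (box (neg φ))

/-- Finite disjunction (the empty one is `⊥`); the order of the disjuncts is immaterial. -/
noncomputable def bigDisj {ι : Type} (s : Finset ι) (f : ι → ModalFormula) : ModalFormula :=
  (s.toList.map f).foldr disj bot

/-- Finite conjunction (the empty one is `⊤`); the order of the conjuncts is immaterial. -/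
noncomputable def bigConj {ι : Type} (s : Finset ι) (f : ι → ModalFormula) : ModalFormula :=
  (s.toList.map f).foldr conj top

/-- `φ` if the state is `true`, the complement of `φ` if the state is `false`. -/
def withState (b : Bool) (φ : ModalFormula) : ModalFormula := if b then φ else neg φ

/-- Uniform substitution. -/
def subst (s : ℕ → ModalFormula) : ModalFormula → ModalFormula
  | var i => s i
  | bot => bot
  | imp φ ψ => imp (subst s φ) (subst s ψ)
  | box φ => box (subst s φ)

/-- Modal degree: the largest number of nested modal operators. -/
def degree : ModalFormula → ℕ
  | var _ => 0
  | bot => 0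
  | imp φ ψ => max (degree φ) (degree ψ)
  | box φ => degree φ + 1

/-- A formula is non-iterative if it has no nested modal operators. -/
def NonIterative (φ : ModalFormula) : Prop := degree φ ≤ 1

/-- Tautologies of the propositional calculus, boxed formulas being treated as atoms. -/
def IsTautology (φ : ModalFormula) : Prop :=
  ∀ e : ModalFormula → Prop, ¬ e bot → (∀ α β, e (imp α β) ↔ (e α → e β)) → e φ

end ModalFormula

open ModalFormula

/-- Normal unimodal logics. The inconsistent logic (all formulas) is one of them. -/
structure IsNormalLogic (L : Set ModalFormula) : Prop where
  taut : ∀ φ, IsTautology φ → φ ∈ L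
  axiomK : ∀ φ ψ, imp (box (imp φ ψ)) (imp (box φ) (box ψ)) ∈ L
  mp : ∀ φ ψ, imp φ ψ ∈ L → φ ∈ L → ψ ∈ L
  nec : ∀ φ, φ ∈ L → box φ ∈ L
  subst : ∀ φ s, φ ∈ L → ModalFormula.subst s φ ∈ L

/-- The normal logic axiomatized by `Γ`: the least normal logic that contains `Γ`. -/
def Ksys (Γ : Set ModalFormula) : Set ModalFormula :=
  ⋂₀ {L | IsNormalLogic L ∧ Γ ⊆ L}

def FinitelyAxiomatizable (L : Set ModalFormula) : Prop :=
  ∃ Γ : Set ModalFormula, Γ.Finite ∧ L = Ksys Γ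

/-- `L` can be axiomatized by a set of non-iterative formulas. -/
def NonIterativeLogic (L : Set ModalFormula) : Prop :=
  ∃ Γ : Set ModalFormula, (∀ φ ∈ Γ, NonIterative φ) ∧ L = Ksys Γ

/-- The Boolean minterm in `p₀, …, p_{v-1}` whose variables have the states `t`. There are
`n = 2 ^ v` of them; the one with all states `true` is the positive one, `m_{n-1}`. -/
noncomputable def boolMinterm (v : ℕ) (t : Fin v → Bool) : ModalFormula :=
  bigConj Finset.univ fun i : Fin v => withState (t i) (var i)

noncomputable def posMinterm (v : ℕ) : ModalFormula := boolMinterm v fun _ => true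

/-- The degree one minterm of the positive section with states `ε` of the modal factors
`◇ m_t`: the product of `m_{n-1}` and of all `◇ m_t`, complemented where `ε t = false`. -/
noncomputable def modalMinterm (v : ℕ) (ε : (Fin v → Bool) → Bool) : ModalFormula :=
  conj (posMinterm v)
    (bigConj Finset.univ fun t : Fin v → Bool => withState (ε t) (dia (boolMinterm v t)))

/-- The number of modal factors in state `true`. -/
def countTrue (v : ℕ) (ε : (Fin v → Bool) → Bool) : ℕ :=
  (Finset.univ.filter fun t => ε t = true).card

/-- The K-plane axiom with coordinates `(x, y)` in the context of `v` variables. -/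
noncomputable def axiomSK (v x : ℕ) (y : ℤ) : ModalFormula :=
  imp (posMinterm v)
    (disj
      (bigDisj
        (Finset.univ.filter fun ε : (Fin v → Bool) → Bool =>
          ε (fun _ => true) = false ∧ countTrue v ε ≤ x)
        (modalMinterm v))
      (bigDisj
        (Finset.univ.filter fun ε : (Fin v → Bool) → Bool =>
          ε (fun _ => true) = true ∧ (countTrue v ε : ℤ) ≤ y + 1)
        (modalMinterm v)))

/-- The D-plane axiom with coordinates `(x, y)` in the context of `v` variables. -/
noncomputable def axiomSD (v x : ℕ) (y : ℤ) : ModalFormula :=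
  conj (dia top) (axiomSK v x y)

/-- The coordinates that occur in the context of `v` variables, where `n = 2 ^ v`:
`0 ≤ x ≤ n - 1`, `-1 ≤ y ≤ n - 1` and `x ≤ y + 1`. -/
def InContext (v x : ℕ) (y : ℤ) : Prop :=
  (x : ℤ) ≤ 2 ^ v - 1 ∧ -1 ≤ y ∧ y ≤ 2 ^ v - 1 ∧ (x : ℤ) ≤ y + 1

/-- The position in the assembled lattice of the systems with coordinates `(x, y)` in the context
of `v` variables; `⊤` is the extra coordinate `*`. With `n = 2 ^ v`, `(n-1, n-1)` goes to
`(*, *)`, `(x, n-1)` with `x ≤ n - 2` goes to `(x, *)`, and `(x, y)` with `y ≤ n - 2` stays. -/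
def position (v x : ℕ) (y : ℤ) : WithTop ℕ × WithTop ℤ :=
  (if (x : ℤ) = 2 ^ v - 1 ∧ y = 2 ^ v - 1 then ⊤ else (x : WithTop ℕ),
   if y = 2 ^ v - 1 then ⊤ else (y : WithTop ℤ))

/-- The positions of the assembled lattice: `-1 ≤ y` and `x ≤ y + 1`, with `*` above all integers
(so that `x = *` forces `y = *`). -/
def IsPosition (x : WithTop ℕ) (y : WithTop ℤ) : Prop :=
  ((-1 : ℤ) : WithTop ℤ) ≤ y ∧ x.map (fun k : ℕ => (k : ℤ)) ≤ y + 1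

/-- The least number of variables of a context in which the position `(x, y)` occurs. -/
noncomputable def firstContext (x : WithTop ℕ) (y : WithTop ℤ) : ℕ :=
  sInf {v : ℕ | ∃ (a : ℕ) (b : ℤ), InContext v a b ∧ position v a b = (x, y)}

/-- The system `S_K(x, y)`: a coordinate `*` is `n - 1` in the first context of the position. -/
noncomputable def SK (x : WithTop ℕ) (y : WithTop ℤ) : Set ModalFormula :=
  Ksys {axiomSK (firstContext x y) (x.untopD (2 ^ firstContext x y - 1))
    (y.untopD (2 ^ firstContext x y - 1))}

/-- The system `S_D(x, y)`: a coordinate `*` is `n - 1` in the first context of the position. -/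
noncomputable def SD (x : WithTop ℕ) (y : WithTop ℤ) : Set ModalFormula :=
  Ksys {axiomSD (firstContext x y) (x.untopD (2 ^ firstContext x y - 1))
    (y.untopD (2 ^ firstContext x y - 1))}

/-! At a point of the canonical model, a non-iterative formula in `v` variables sees only the
Boolean type of the point and the set of Boolean types of its successors. A substitution that
permutes the types (`flipType`) makes the type of the point positive, so the non-iterative theorems
of a normal logic are determined by the minterms μ_ε that it refutes (`mem_of_excluded_imp`).

Refutation is a matter of counting. A map of types that sends positive to positive and the true set
of δ onto that of ε is realised by a substitution, so refuting ε refutes δ (`Excluded.of_map`). Such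
a map exists once δ has at least as many true factors as ε, ε is nonempty if δ is, and ε is
reflexive (contains ◇m_{n-1}) if δ is (`Excluded.of_card`). Hence, for any number of variables, the
nonempty refuted minterms are those whose count exceeds a threshold: x for irreflexive ones, y + 1
for reflexive ones. Here x ≤ y + 1, since refuting a reflexive minterm refutes the irreflexive ones
of the same count. What remains is whether the empty minterm is refuted, that is, whether ◇⊤ is a
theorem; this separates the D-plane from the K-plane.

A single axiom in a single context expresses both thresholds (`axiomSK_mem_iff_boundedBy`), and
every normal logic has such thresholds (`exists_position`). So each non-iterative logic has one of
the listed formulas as its only axiom. -/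

/-! ### Valuations and canonical points -/

/-- A classical valuation that treats boxed formulas as atoms. -/
structure IsValuation (e : ModalFormula → Prop) : Prop where
  bot : ¬ e bot
  imp : ∀ α β, e (imp α β) ↔ (e α → e β)

namespace IsValuation

variable {e : ModalFormula → Prop}

theorem neg (he : IsValuation e) (φ : ModalFormula) : e (neg φ) ↔ ¬ e φ := by
  simp [ModalFormula.neg, he.imp, he.bot]

theorem top (he : IsValuation e) : e top := by
  simp [ModalFormula.top, he.neg, he.bot]

theorem disj (he : IsValuation e) (φ ψ : ModalFormula) : e (disj φ ψ) ↔ e φ ∨ e ψ := by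
  simp only [ModalFormula.disj, he.imp, he.neg]
  tauto

theorem conj (he : IsValuation e) (φ ψ : ModalFormula) : e (conj φ ψ) ↔ e φ ∧ e ψ := by
  simp only [ModalFormula.conj, he.imp, he.neg]
  tauto

theorem bigDisj (he : IsValuation e) {ι : Type} (s : Finset ι) (f : ι → ModalFormula) :
    e (bigDisj s f) ↔ ∃ i ∈ s, e (f i) := by
  have key : ∀ l : List ι, e ((l.map f).foldr ModalFormula.disj ModalFormula.bot) ↔
      ∃ i ∈ l, e (f i) := by
    intro l
    induction l with
    | nil => simp [he.bot]
    | cons a l ih => simp [he.disj, ih]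
  simp [ModalFormula.bigDisj, key]

theorem bigConj (he : IsValuation e) {ι : Type} (s : Finset ι) (f : ι → ModalFormula) :
    e (bigConj s f) ↔ ∀ i ∈ s, e (f i) := by
  have key : ∀ l : List ι, e ((l.map f).foldr ModalFormula.conj ModalFormula.top) ↔
      ∀ i ∈ l, e (f i) := by
    intro l
    induction l with
    | nil => simp [he.top]
    | cons a l ih => simp [he.conj, ih]
  simp [ModalFormula.bigConj, key]

theorem withState (he : IsValuation e) (b : Bool) (φ : ModalFormula) :
    e (withState b φ) ↔ (b = true ↔ e φ) := by
  cases b <;> simp [ModalFormula.withState, he.neg]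

theorem comp_subst (he : IsValuation e) (s : ℕ → ModalFormula) :
    IsValuation fun φ => e (ModalFormula.subst s φ) :=
  ⟨he.bot, fun _ _ => he.imp _ _⟩

end IsValuation

/-- Sets of formulas closed under propositional consequence. -/
structure IsTheory (T : Set ModalFormula) : Prop where
  taut : ∀ φ, IsTautology φ → φ ∈ T
  mp : ∀ φ ψ, imp φ ψ ∈ T → φ ∈ T → ψ ∈ T

theorem IsTheory.relativize {T : Set ModalFormula} (hT : IsTheory T) (α : ModalFormula) :
    IsTheory {ψ | imp α ψ ∈ T} where
  taut φ h := hT.taut _ fun e h0 hi => by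
    rw [hi]
    exact fun _ => h e h0 hi
  mp φ ψ h1 h2 := by
    refine hT.mp _ _ (hT.mp _ _ (hT.taut _ ?_) h1) h2
    intro e h0 hi
    simp only [hi]
    tauto

/-- Lindenbaum's lemma. -/
theorem IsTheory.exists_valuation {T : Set ModalFormula} (hT : IsTheory T) {φ : ModalFormula}
    (hφ : φ ∉ T) : ∃ e, IsValuation e ∧ (∀ ψ ∈ T, e ψ) ∧ ¬ e φ := by
  obtain ⟨M, hTM, hM⟩ := zorn_subset_nonempty {T' | IsTheory T' ∧ φ ∉ T'} (by
    intro c hc hchain hne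
    refine ⟨⋃₀ c, ⟨⟨fun ψ h => ?_, fun α β h1 h2 => ?_⟩, ?_⟩, fun s hs => Set.subset_sUnion_of_mem hs⟩
    · obtain ⟨s, hs⟩ := hne
      exact ⟨s, hs, (hc hs).1.taut _ h⟩
    · obtain ⟨s, hs, h1⟩ := h1
      obtain ⟨t, ht, h2⟩ := h2
      rcases hchain.total hs ht with h | h
      · exact ⟨t, ht, (hc ht).1.mp _ _ (h h1) h2⟩
      · exact ⟨s, hs, (hc hs).1.mp _ _ h1 (h h2)⟩
    · rintro ⟨s, hs, h⟩
      exact (hc hs).2 h) T ⟨hT, hφ⟩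
  obtain ⟨hMT, hMφ⟩ := hM.prop
  -- Otherwise {ψ | α → ψ ∈ M} would be a theory omitting φ that contains M and α, against
  -- maximality.
  have key : ∀ α, α ∉ M → imp α φ ∈ M := by
    intro α hα
    by_contra hcon
    refine hα (hM.le_of_ge (y := {ψ | imp α ψ ∈ M}) ⟨hMT.relativize α, hcon⟩ (fun ψ hψ => ?_) ?_)
    · refine hMT.mp _ _ (hMT.taut _ fun e h0 hi => ?_) hψ
      simp only [hi]
      tauto
    · refine hMT.taut _ fun e h0 hi => ?_
      simp only [hi]
      tauto
  refine ⟨(· ∈ M), ⟨fun h => hMφ ?_, fun α β => ⟨hMT.mp _ _, fun h => ?_⟩⟩, fun ψ h => hTM h, hMφ⟩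
  · refine hMT.mp _ _ (hMT.taut _ fun e h0 hi => ?_) h
    simp only [hi]
    tauto
  · by_contra hcon
    by_cases hβ : β ∈ M
    · refine hcon (hMT.mp _ _ (hMT.taut _ fun e h0 hi => ?_) hβ)
      simp only [hi]
      tauto
    · have hα : α ∉ M := fun hα => hβ (h hα)
      -- One of α and α → β always holds, so φ follows from α → φ and (α → β) → φ.
      refine hMφ (hMT.mp _ _ (hMT.mp _ _ (hMT.taut _ fun e h0 hi => ?_) (key _ hα)) (key _ hcon))
      simp only [hi]
      tauto

theorem IsNormalLogic.isTheory {L : Set ModalFormula} (hL : IsNormalLogic L) : IsTheory L :=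
  ⟨hL.taut, hL.mp⟩

/-- Points of the canonical model of `L`. -/
structure IsPoint (L : Set ModalFormula) (e : ModalFormula → Prop) : Prop where
  val : IsValuation e
  mem : ∀ φ ∈ L, e φ

/-- `e'` is a successor of `e` in the canonical model of `L`. -/
structure IsSucc (L : Set ModalFormula) (e e' : ModalFormula → Prop) : Prop where
  point : IsPoint L e'
  box : ∀ φ, e (box φ) → e' φ

section Canonical

variable {L S : Set ModalFormula} {e : ModalFormula → Prop}

theorem mem_iff_forall_isPoint (hL : IsNormalLogic L) {φ : ModalFormula} :
    φ ∈ L ↔ ∀ e, IsPoint L e → e φ := by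
  refine ⟨fun h e he => he.mem _ h, fun h => ?_⟩
  by_contra hφ
  obtain ⟨e, h1, h2, h3⟩ := hL.isTheory.exists_valuation hφ
  exact h3 (h e ⟨h1, h2⟩)

theorem IsPoint.box_iff (hL : IsNormalLogic L) (he : IsPoint L e) (φ : ModalFormula) :
    e (box φ) ↔ ∀ e', IsSucc L e e' → e' φ := by
  refine ⟨fun h e' he' => he'.box _ h, fun h => ?_⟩
  by_contra hφ
  have hT : IsTheory {ψ | e (box ψ)} :=
    ⟨fun ψ hψ => he.mem _ (hL.nec _ (hL.taut _ hψ)), fun α β h1 h2 =>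
      (he.val.imp _ _).1 ((he.val.imp _ _).1 (he.mem _ (hL.axiomK α β)) h1) h2⟩
  obtain ⟨e', h1, h2, h3⟩ := hT.exists_valuation hφ
  exact h3 (h e' ⟨⟨h1, fun ψ hψ => h2 _ (he.mem _ (hL.nec _ hψ))⟩, h2⟩)

theorem IsPoint.dia_iff (hL : IsNormalLogic L) (he : IsPoint L e) (φ : ModalFormula) :
    e (dia φ) ↔ ∃ e', IsSucc L e e' ∧ e' φ := by
  rw [dia, he.val.neg, he.box_iff hL]
  push Not
  exact exists_congr fun e' => and_congr_right fun h => by rw [h.point.val.neg, not_not]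

theorem IsPoint.comp_subst (hL : IsNormalLogic L) (he : IsPoint L e) (s : ℕ → ModalFormula) :
    IsPoint L fun φ => e (subst s φ) :=
  ⟨he.val.comp_subst s, fun φ h => he.mem _ (hL.subst φ s h)⟩

theorem subst_var (φ : ModalFormula) : subst var φ = φ := by
  induction φ <;> simp_all [subst]

/-! ### Boolean types -/

/-- The states of `p₀, …, p_{v-1}` under a valuation. -/
noncomputable def boolType (v : ℕ) (e : ModalFormula → Prop) : Fin v → Bool :=
  open Classical in fun i => decide (e (var i))

theorem boolType_apply (v : ℕ) (e : ModalFormula → Prop) (i : Fin v) :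
    boolType v e i = true ↔ e (var i) := by
  simp [boolType]

theorem IsValuation.boolMinterm (he : IsValuation e) (v : ℕ) (t : Fin v → Bool) :
    e (boolMinterm v t) ↔ boolType v e = t := by
  simp only [_root_.boolMinterm, he.bigConj, he.withState, Finset.mem_univ, true_imp_iff, funext_iff,
    ← boolType_apply]
  exact forall_congr' fun i => by
    cases t i <;> simp

/-- A substitution that acts on the Boolean types as `f`. -/
noncomputable def typeSubst {v w : ℕ} (f : (Fin w → Bool) → Fin v → Bool) (i : ℕ) : ModalFormula :=
  if h : i < v then bigDisj (Finset.univ.filter fun t => f t ⟨i, h⟩ = true) (boolMinterm w)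
  else var i

/-- Exactly one `boolMinterm w t` holds under `e`, namely that of the type of `e`; hence the
disjunction substituted for `var i` is true iff `f` of that type is true at `i`. -/
theorem boolType_typeSubst (he : IsValuation e) {v w : ℕ} (f : (Fin w → Bool) → Fin v → Bool) :
    boolType v (fun φ => e (subst (typeSubst f) φ)) = f (boolType w e) := by
  funext i
  rw [Bool.eq_iff_iff, boolType_apply]
  simp [subst, typeSubst, he.bigDisj, he.boolMinterm]

/-- The modal factors are read off the successors of `e` itself, each composed with `s`; the
canonical successors of the composed point need not be considered. -/
theorem IsPoint.subst_modalMinterm (hL : IsNormalLogic L) (he : IsPoint L e)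
    (s : ℕ → ModalFormula) (v : ℕ) (ε : (Fin v → Bool) → Bool) :
    e (subst s (modalMinterm v ε)) ↔
      boolType v (fun φ => e (subst s φ)) = (fun _ => true) ∧
        ∀ t, ε t = true ↔ ∃ e', IsSucc L e e' ∧ boolType v (fun φ => e' (subst s φ)) = t := by
  have hs := he.val.comp_subst s
  refine (hs.conj _ _).trans (and_congr (hs.boolMinterm v _) ((hs.bigConj _ _).trans ?_))
  simp only [Finset.mem_univ, true_imp_iff]
  refine forall_congr' fun t => (hs.withState _ _).trans (iff_congr Iff.rfl ?_)
  change e (dia (subst s (boolMinterm v t))) ↔ _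
  rw [he.dia_iff hL]
  exact exists_congr fun e' => and_congr_right fun h =>
    (h.point.val.comp_subst s).boolMinterm v t

theorem IsPoint.modalMinterm (hL : IsNormalLogic L) (he : IsPoint L e)
    (v : ℕ) (ε : (Fin v → Bool) → Bool) :
    e (modalMinterm v ε) ↔ boolType v e = (fun _ => true) ∧
        ∀ t, ε t = true ↔ ∃ e', IsSucc L e e' ∧ boolType v e' = t := by
  simpa only [subst_var] using he.subst_modalMinterm hL var v ε

/-- All variables of the formula have an index below this number. -/
def ModalFormula.varBound : ModalFormula → ℕ
  | var i => i + 1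
  | bot => 0
  | imp φ ψ => max (varBound φ) (varBound ψ)
  | box φ => varBound φ

theorem eval_congr_of_degree_eq_zero {d e : ModalFormula → Prop} (hd : IsValuation d)
    (he : IsValuation e) {v : ℕ} (h : boolType v d = boolType v e) {φ : ModalFormula}
    (hφ : degree φ = 0) (hv : varBound φ ≤ v) : d φ ↔ e φ := by
  induction φ with
  | var i =>
    have := congrFun h ⟨i, hv⟩
    rwa [Bool.eq_iff_iff, boolType_apply, boolType_apply] at this
  | bot => simp [hd.bot, he.bot]
  | imp α β iα iβ =>
    simp only [degree, varBound, Nat.max_eq_zero_iff, max_le_iff] at hφ hv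
    rw [hd.imp, he.imp, iα hφ.1 hv.1, iβ hφ.2 hv.2]
  | box α => simp [degree] at hφ

/-- Below a box the formula is Boolean, so a box only quantifies over the types of the successors.
Two different logics are allowed, so that a theorem of one can be carried to a point of the other.
-/
theorem eval_subst_congr_of_nonIterative {d e : ModalFormula → Prop} (hL : IsNormalLogic L)
    (hS : IsNormalLogic S) (hd : IsPoint L d) (he : IsPoint S e) (s : ℕ → ModalFormula) {v : ℕ}
    (h : boolType v (fun φ => d (subst s φ)) = boolType v e)
    (h' : ∀ t, (∃ d', IsSucc L d d' ∧ boolType v (fun φ => d' (subst s φ)) = t) ↔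
      ∃ e', IsSucc S e e' ∧ boolType v e' = t) {φ : ModalFormula}
    (hφ : NonIterative φ) (hv : varBound φ ≤ v) : d (subst s φ) ↔ e φ := by
  unfold NonIterative at hφ
  induction φ with
  | var i => exact eval_congr_of_degree_eq_zero (hd.val.comp_subst s) he.val h rfl hv
  | bot => exact eval_congr_of_degree_eq_zero (hd.val.comp_subst s) he.val h rfl hv
  | imp α β iα iβ =>
    simp only [degree, varBound, max_le_iff] at hφ hv
    rw [subst, hd.val.imp, he.val.imp, iα hφ.1 hv.1, iβ hφ.2 hv.2]
  | box α =>
    replace hφ : degree α = 0 := Nat.le_zero.1 (Nat.le_of_succ_le_succ hφ)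
    rw [varBound] at hv
    rw [subst, hd.box_iff hL, he.box_iff hS]
    constructor
    · intro H e' he'
      obtain ⟨d', hd', hd''⟩ := (h' _).2 ⟨e', he', rfl⟩
      exact (eval_congr_of_degree_eq_zero (hd'.point.val.comp_subst s) he'.point.val hd'' hφ hv).1
        (H d' hd')
    · intro H d' hd'
      obtain ⟨e', he', he''⟩ := (h' _).1 ⟨d', hd', rfl⟩
      exact (eval_congr_of_degree_eq_zero (hd'.point.val.comp_subst s) he'.point.val he''.symm
        hφ hv).2 (H e' he')

/-! ### Excluded minterms -/

/-- The minterm with states `ε` is inconsistent with `L`. -/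
def Excluded (L : Set ModalFormula) (v : ℕ) (ε : (Fin v → Bool) → Bool) : Prop :=
  neg (modalMinterm v ε) ∈ L

theorem excluded_iff (hL : IsNormalLogic L) {v : ℕ} {ε : (Fin v → Bool) → Bool} :
    Excluded L v ε ↔ ∀ e, IsPoint L e → ¬ e (modalMinterm v ε) := by
  rw [Excluded, mem_iff_forall_isPoint hL]
  exact forall₂_congr fun e he => he.val.neg _

/-- A point satisfying δ, composed with `typeSubst f`, would satisfy ε, because the types of its
successors are moved by `f`. -/
theorem Excluded.of_map (hL : IsNormalLogic L) {v w : ℕ} {ε : (Fin v → Bool) → Bool}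
    (h : Excluded L v ε) {δ : (Fin w → Bool) → Bool} (f : (Fin w → Bool) → Fin v → Bool)
    (hf : f (fun _ => true) = fun _ => true)
    (hε : ∀ t, ε t = true ↔ ∃ u, δ u = true ∧ f u = t) : Excluded L w δ := by
  rw [excluded_iff hL] at h ⊢
  intro e he hδ
  refine h _ (he.comp_subst hL (typeSubst f)) ?_
  rw [he.modalMinterm hL] at hδ
  rw [he.subst_modalMinterm hL, boolType_typeSubst he.val, hδ.1]
  refine ⟨hf, fun t => ?_⟩
  rw [hε]
  constructor
  · rintro ⟨u, hu, rfl⟩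
    obtain ⟨e', he', rfl⟩ := (hδ.2 u).1 hu
    exact ⟨e', he', boolType_typeSubst he'.point.val f⟩
  · rintro ⟨e', he', h'⟩
    exact ⟨boolType w e', (hδ.2 _).2 ⟨e', he', rfl⟩, by rw [← h', boolType_typeSubst he'.point.val f]⟩

/-- The involution of the Boolean types that exchanges `t₀` with the positive type. -/
def flipType {v : ℕ} (t₀ t : Fin v → Bool) : Fin v → Bool := fun i => t₀ i == t i

theorem flipType_flipType {v : ℕ} (t₀ t : Fin v → Bool) : flipType t₀ (flipType t₀ t) = t := by
  funext i
  simp only [flipType]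
  cases t₀ i <;> cases t i <;> rfl

theorem flipType_self {v : ℕ} (t₀ : Fin v → Bool) : flipType t₀ t₀ = fun _ => true := by
  funext i
  simp [flipType]

/-- A non-iterative theorem of `L` belongs to every normal logic that excludes all the minterms
which `L` excludes. -/
theorem mem_of_excluded_imp (hL : IsNormalLogic L) (hS : IsNormalLogic S)
    (h : ∀ v ε, Excluded L v ε → Excluded S v ε) {γ : ModalFormula} (hγ : NonIterative γ)
    (hγL : γ ∈ L) : γ ∈ S := by
  classical
  rw [mem_iff_forall_isPoint hS]
  intro e he
  set v := varBound γ
  set t₀ := boolType v e with ht₀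
  set s := typeSubst (flipType t₀) with hs
  -- The successor types of `e` after the flip that makes its own type positive; the flipped `e`
  -- witnesses that `S` does not refute this minterm.
  set ε : (Fin v → Bool) → Bool := fun t =>
    decide (∃ e', IsSucc S e e' ∧ boolType v (fun φ => e' (subst s φ)) = t) with hε
  have hnS : ¬ Excluded S v ε := by
    rw [excluded_iff hS]
    intro H
    refine H _ (he.comp_subst hS s) ?_
    rw [he.subst_modalMinterm hS, boolType_typeSubst he.val, ← ht₀, flipType_self]
    exact ⟨rfl, fun t => by simp [hε]⟩
  have hnL : ¬ Excluded L v ε := fun H => hnS (h v ε H)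
  rw [excluded_iff hL] at hnL
  push Not at hnL
  obtain ⟨d, hd, hdε⟩ := hnL
  rw [hd.modalMinterm hL] at hdε
  -- The flip is an involution: applied to `d`, it restores the type of `e` and the successor types
  -- of `e`. The theorem used at `d` is the substituted γ.
  refine (eval_subst_congr_of_nonIterative hL hS hd he s (v := v) ?_ ?_ hγ le_rfl).1
    (hd.mem _ (hL.subst _ _ hγL))
  · rw [boolType_typeSubst hd.val, hdε.1, ← flipType_self t₀, flipType_flipType]
  · have key : ∀ t, (∃ d', IsSucc L d d' ∧ boolType v d' = t) ↔
        ∃ e', IsSucc S e e' ∧ flipType t₀ (boolType v e') = t := by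
      intro t
      rw [← hdε.2 t]
      simp only [hε, decide_eq_true_eq]
      exact exists_congr fun e' => and_congr_right fun he' => by
        rw [boolType_typeSubst he'.point.val]
    intro t
    constructor
    · rintro ⟨d', hd', rfl⟩
      obtain ⟨e', he', hh⟩ := (key _).1 ⟨d', hd', rfl⟩
      exact ⟨e', he', by rw [boolType_typeSubst hd'.point.val, ← hh, flipType_flipType]⟩
    · rintro ⟨e', he', rfl⟩
      obtain ⟨d', hd', hh⟩ := (key _).2 ⟨e', he', rfl⟩
      exact ⟨d', hd', by rw [boolType_typeSubst hd'.point.val, hh, flipType_flipType]⟩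

end Canonical

/-! ### Counting -/

theorem exists_map_image {X Y : Type} [DecidableEq X] [DecidableEq Y] (x₀ : X) (y₀ : Y)
    {A : Finset X} {B : Finset Y} (hcard : B.card ≤ A.card) (hne : A.Nonempty → B.Nonempty)
    (h : x₀ ∈ A → y₀ ∈ B) : ∃ f : X → Y, f x₀ = y₀ ∧ ∀ y, y ∈ B ↔ ∃ x, x ∈ A ∧ f x = y := by
  classical
  -- A subset of `A'` of the size of `B'` is matched with `B'`; all other points follow the default
  -- `g₀`.
  have aux : ∀ (A' : Finset X) (B' : Finset Y), B'.card ≤ A'.card → ∀ g₀ : X → Y,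
      ∃ f : X → Y, (∀ x, x ∉ A' → f x = g₀ x) ∧ (∀ x ∈ A', f x ∈ B' ∨ f x = g₀ x) ∧
        ∀ y ∈ B', ∃ x ∈ A', f x = y := by
    intro A' B' hc g₀
    obtain ⟨A'', hA, hc'⟩ := Finset.exists_subset_card_eq hc
    let φ : A'' ≃ B' := Finset.equivOfCardEq hc'
    refine ⟨fun x => if hx : x ∈ A'' then φ ⟨x, hx⟩ else g₀ x, fun x hx => ?_, fun x hx => ?_,
      fun y hy => ⟨φ.symm ⟨y, hy⟩, hA (φ.symm ⟨y, hy⟩).2, ?_⟩⟩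
    · exact dif_neg fun h => hx (hA h)
    · by_cases hx' : x ∈ A''
      · left
        simp [hx']
      · right
        simp [hx']
    · simp
  by_cases hx₀ : x₀ ∈ A
  · have hy₀ := h hx₀
    -- The pair `x₀`, `y₀` is matched beforehand, and surplus points of `A` collapse onto `y₀`,
    -- which lies in `B`.
    obtain ⟨f, h1, h2, h3⟩ := aux (A.erase x₀) (B.erase y₀)
      (by rw [Finset.card_erase_of_mem hx₀, Finset.card_erase_of_mem hy₀]; omega) fun _ => y₀
    have hf₀ : f x₀ = y₀ := h1 _ (Finset.notMem_erase _ _)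
    refine ⟨f, hf₀, fun y => ⟨fun hy => ?_, ?_⟩⟩
    · by_cases hyy : y = y₀
      · exact ⟨x₀, hx₀, hf₀.trans hyy.symm⟩
      · obtain ⟨x, hx, hxy⟩ := h3 y (Finset.mem_erase.2 ⟨hyy, hy⟩)
        exact ⟨x, Finset.mem_of_mem_erase hx, hxy⟩
    · rintro ⟨x, hx, rfl⟩
      by_cases hxx : x = x₀
      · rwa [hxx, hf₀]
      · rcases h2 x (Finset.mem_erase.2 ⟨hxx, hx⟩) with h' | h'
        · exact Finset.mem_of_mem_erase h'
        · rwa [h']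
  · by_cases hA : A.Nonempty
    · obtain ⟨b, hb⟩ := hne hA
      -- Here `y₀` may lie outside `B`, so surplus points of `A` collapse onto some `b` in `B`
      -- instead.
      obtain ⟨f, h1, h2, h3⟩ := aux A B hcard fun x => if x ∈ A then b else y₀
      refine ⟨f, by rw [h1 _ hx₀, if_neg hx₀], fun y => ⟨h3 y, ?_⟩⟩
      rintro ⟨x, hx, rfl⟩
      rcases h2 x hx with h' | h'
      · exact h'
      · rwa [h', if_pos hx]
    · rw [Finset.not_nonempty_iff_eq_empty] at hA
      subst hA
      have : B = ∅ := by simpa using hcard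
      subst this
      exact ⟨fun _ => y₀, rfl, by simp⟩

theorem exists_boolFun {T : Type} [Fintype T] [DecidableEq T] (A : Finset T) :
    ∃ ε : T → Bool, (∀ t, ε t = true ↔ t ∈ A) :=
  ⟨fun t => decide (t ∈ A), by simp⟩

theorem countTrue_eq_card {v : ℕ} {ε : (Fin v → Bool) → Bool} {A : Finset (Fin v → Bool)}
    (h : ∀ t, ε t = true ↔ t ∈ A) : countTrue v ε = A.card := by
  rw [countTrue]
  congr 1
  ext t
  simp [h]

theorem countTrue_le {v : ℕ} (ε : (Fin v → Bool) → Bool) : countTrue v ε ≤ 2 ^ v := by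
  simpa [countTrue] using Finset.card_le_univ (Finset.univ.filter fun t => ε t = true)

theorem countTrue_pos {v : ℕ} {ε : (Fin v → Bool) → Bool} {t : Fin v → Bool} (h : ε t = true) :
    1 ≤ countTrue v ε :=
  Finset.card_pos.2 ⟨t, by simp [h]⟩

theorem countTrue_lt {v : ℕ} {ε : (Fin v → Bool) → Bool} {t : Fin v → Bool} (h : ε t = false) :
    countTrue v ε < 2 ^ v := by
  have := Finset.card_lt_univ_of_notMem (s := Finset.univ.filter fun t => ε t = true) (x := t)
    (by simp [h])
  simpa [countTrue] using this

theorem exists_countTrue_of_reflexive {v k : ℕ} (h1 : 1 ≤ k) (h2 : k ≤ 2 ^ v) :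
    ∃ ε : (Fin v → Bool) → Bool, ε (fun _ => true) = true ∧ countTrue v ε = k := by
  obtain ⟨A, hA, -, hc⟩ := Finset.exists_subsuperset_card_eq
    (Finset.subset_univ {(fun _ => true : Fin v → Bool)}) (n := k) (by simpa) (by simpa)
  obtain ⟨ε, hε⟩ := exists_boolFun A
  exact ⟨ε, (hε _).2 (hA (Finset.mem_singleton_self _)), by rw [countTrue_eq_card hε, hc]⟩

theorem exists_countTrue_of_irreflexive {v k : ℕ} (h : k < 2 ^ v) :
    ∃ ε : (Fin v → Bool) → Bool, ε (fun _ => true) = false ∧ countTrue v ε = k := by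
  obtain ⟨A, hA, hc⟩ := Finset.exists_subset_card_eq
    (s := Finset.univ.erase (fun _ => true : Fin v → Bool)) (n := k)
    (by rw [Finset.card_erase_of_mem (Finset.mem_univ _)]; simp; omega)
  obtain ⟨ε, hε⟩ := exists_boolFun A
  refine ⟨ε, ?_, by rw [countTrue_eq_card hε, hc]⟩
  rw [← Bool.not_eq_true, hε]
  exact fun h => by simpa using hA h

/-! ### Exclusion depends only on the count and on the positive factor -/

section Exclusion

variable {L S : Set ModalFormula}

theorem Excluded.of_card (hL : IsNormalLogic L) {v w : ℕ} {ε : (Fin v → Bool) → Bool}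
    {δ : (Fin w → Bool) → Bool} (h : Excluded L v ε) (hcard : countTrue v ε ≤ countTrue w δ)
    (hpos : 1 ≤ countTrue w δ → 1 ≤ countTrue v ε)
    (htop : δ (fun _ => true) = true → ε (fun _ => true) = true) : Excluded L w δ := by
  obtain ⟨f, hf, hf'⟩ := exists_map_image (fun _ => true : Fin w → Bool)
    (fun _ => true : Fin v → Bool) hcard (fun h => Finset.card_pos.1 (hpos (Finset.card_pos.2 h)))
    (by simpa using htop)
  exact h.of_map hL f hf (by simpa using hf')

/-- The empty minterm passes between contexts by `Excluded.of_card`. Without variables there is one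
type, so there the minterm says just that no successor exists. -/
theorem excluded_const_false_iff (hL : IsNormalLogic L) {v : ℕ} :
    Excluded L v (fun _ => false) ↔ dia top ∈ L := by
  constructor
  · intro h
    have h0 : Excluded L 0 (fun _ => false) := h.of_card hL (by simp [countTrue])
      (by simp [countTrue]) (by simp)
    rw [excluded_iff hL] at h0
    rw [mem_iff_forall_isPoint hL]
    intro e he
    rw [he.dia_iff hL]
    by_contra hcon
    refine h0 e he ((he.modalMinterm hL _ _).2 ⟨Subsingleton.elim _ _, fun t => ?_⟩)
    simp only [Bool.false_eq_true, false_iff]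
    rintro ⟨e', he', -⟩
    exact hcon ⟨e', he', he'.point.val.top⟩
  · intro h
    rw [excluded_iff hL]
    intro e he hm
    obtain ⟨e', he', -⟩ := (he.dia_iff hL _).1 (he.mem _ h)
    simpa using ((he.modalMinterm hL _ _).1 hm).2 (boolType v e') |>.2 ⟨e', he', rfl⟩

theorem eq_const_false_of_countTrue {v : ℕ} {ε : (Fin v → Bool) → Bool} (h : countTrue v ε = 0) :
    ε = fun _ => false := by
  funext t
  by_contra ht
  have := countTrue_pos (Bool.eq_true_of_not_eq_false ht)
  omega

theorem axiomSK_mem_iff (hL : IsNormalLogic L) {v a : ℕ} {b : ℤ} :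
    axiomSK v a b ∈ L ↔ ∀ ε,
      (ε (fun _ => true) = false → a < countTrue v ε → Excluded L v ε) ∧
      (ε (fun _ => true) = true → b + 1 < countTrue v ε → Excluded L v ε) := by
  classical
  constructor
  · intro h ε
    have key : ∀ e, IsPoint L e → e (modalMinterm v ε) →
        (ε (fun _ => true) = false ∧ countTrue v ε ≤ a) ∨
          (ε (fun _ => true) = true ∧ (countTrue v ε : ℤ) ≤ b + 1) := by
      intro e he hε
      have hε' := (he.modalMinterm hL _ _).1 hε
      have h1 := he.mem _ h
      rw [axiomSK, he.val.imp, posMinterm, he.val.boolMinterm, he.val.disj, he.val.bigDisj,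
        he.val.bigDisj] at h1
      -- A point satisfies at most one minterm, so the true disjunct must be ε itself.
      have huniq : ∀ δ, e (modalMinterm v δ) → δ = ε := by
        intro δ hδ
        funext t
        rw [Bool.eq_iff_iff, ((he.modalMinterm hL _ _).1 hδ).2, hε'.2]
      rcases h1 hε'.1 with ⟨δ, hδ, hδ'⟩ | ⟨δ, hδ, hδ'⟩
      · rw [huniq δ hδ'] at hδ
        exact Or.inl (by simpa using hδ)
      · rw [huniq δ hδ'] at hδ
        exact Or.inr (by simpa using hδ)
    simp only [excluded_iff hL]
    refine ⟨fun h1 h2 e he hε => ?_, fun h1 h2 e he hε => ?_⟩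
    · rcases key e he hε with h3 | h3
      · omega
      · simp [h1] at h3
    · rcases key e he hε with h3 | h3
      · simp [h1] at h3
      · omega
  · intro h
    rw [mem_iff_forall_isPoint hL]
    intro e he
    rw [axiomSK, he.val.imp, posMinterm, he.val.boolMinterm, he.val.disj, he.val.bigDisj,
      he.val.bigDisj]
    intro ht
    set ε : (Fin v → Bool) → Bool := fun t => decide (∃ e', IsSucc L e e' ∧ boolType v e' = t)
      with hε
    have hm : e (modalMinterm v ε) := (he.modalMinterm hL _ _).2 ⟨ht, fun t => by simp [hε]⟩
    have hn : ¬ Excluded L v ε := fun hx => (excluded_iff hL).1 hx e he hm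
    cases hT : ε (fun _ => true) with
    | false =>
      exact Or.inl ⟨ε, by simpa [hT] using fun hlt => hn ((h ε).1 hT hlt), hm⟩
    | true =>
      refine Or.inr ⟨ε, ?_, hm⟩
      simp only [Finset.mem_filter, Finset.mem_univ, true_and, hT]
      by_contra hlt
      exact hn ((h ε).2 hT (not_le.1 hlt))

theorem conj_mem_iff (hL : IsNormalLogic L) {φ ψ : ModalFormula} :
    conj φ ψ ∈ L ↔ φ ∈ L ∧ ψ ∈ L := by
  simp only [mem_iff_forall_isPoint hL, ← forall_and]
  exact forall₂_congr fun e he => he.val.conj _ _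

/-- In all contexts, `L` excludes the minterms beyond the position `(x, y)`. -/
def BoundedBy (L : Set ModalFormula) (x : WithTop ℕ) (y : WithTop ℤ) : Prop :=
  ∀ (v : ℕ) (ε : (Fin v → Bool) → Bool),
    (ε (fun _ => true) = false → x < (countTrue v ε : WithTop ℕ) → Excluded L v ε) ∧
    (ε (fun _ => true) = true → y + 1 < (((countTrue v ε : ℕ) : ℤ) : WithTop ℤ) → Excluded L v ε)

/-- The first excluded minterms of the context, of count a + 1 (irreflexive) and b + 2 (reflexive),
exclude all larger ones in every context. A coordinate `*` means that no minterm of the context is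
large enough to be excluded on that side. -/
theorem axiomSK_mem_iff_boundedBy (hL : IsNormalLogic L) {v a : ℕ} {b : ℤ} {x : WithTop ℕ}
    {y : WithTop ℤ} (hc : InContext v a b) (hp : position v a b = (x, y)) :
    axiomSK v a b ∈ L ↔ BoundedBy L x y := by
  rw [axiomSK_mem_iff hL]
  obtain ⟨ha, hb, hb', hab⟩ := hc
  have hn : ((2 ^ v : ℕ) : ℤ) = 2 ^ v := by push_cast; rfl
  simp only [position, Prod.mk.injEq] at hp
  obtain ⟨rfl, rfl⟩ := hp
  constructor
  · intro h w δ
    by_cases hbn : b = 2 ^ v - 1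
    · simp only [hbn, and_true, if_true]
      refine ⟨fun hT hlt => ?_, fun hT hlt => absurd hlt (by simp)⟩
      by_cases han : (a : ℤ) = 2 ^ v - 1
      · simp [han] at hlt
      · rw [if_neg han, Nat.cast_lt] at hlt
        obtain ⟨ε, hε, hk⟩ := exists_countTrue_of_irreflexive (v := v) (k := a + 1) (by omega)
        exact ((h ε).1 hε (by omega)).of_card hL (by omega) (by omega) (by simp [hT])
    · simp only [hbn, and_false, if_false]
      obtain ⟨ε, hε, hk⟩ := exists_countTrue_of_reflexive (v := v) (k := (b + 2).toNat)
        (by omega) (by omega)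
      have hex := (h ε).2 hε (by omega)
      refine ⟨fun hT hlt => ?_, fun hT hlt => ?_⟩
      · rw [Nat.cast_lt] at hlt
        by_cases han : (a : ℤ) = 2 ^ v - 1
        -- Here a = n - 1 and b = n - 2. No irreflexive minterm of the context has n true factors,
        -- but the excluded reflexive one of count b + 2 = n also excludes irreflexive minterms.
        · exact hex.of_card hL (by omega) (by omega) (by simp [hT])
        · obtain ⟨ε', hε', hk'⟩ := exists_countTrue_of_irreflexive (v := v) (k := a + 1) (by omega)
          exact ((h ε').1 hε' (by omega)).of_card hL (by omega) (by omega) (by simp [hT])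
      · have hlt' : b + 1 < (countTrue w δ : ℤ) := by exact_mod_cast hlt
        exact hex.of_card hL (by omega) (by omega) (by simp [hε])
  · intro h ε
    refine ⟨fun hT hlt => (h v ε).1 hT ?_, fun hT hlt => (h v ε).2 hT ?_⟩
    -- An irreflexive count is at most n - 1, so a count above a rules out a = n - 1 and the
    -- coordinate is not `⊤`.
    · have := countTrue_lt hT
      rw [if_neg (by omega)]
      exact_mod_cast hlt
    · have := countTrue_le ε
      rw [if_neg (by omega)]
      exact_mod_cast hlt

end Exclusion

/-! ### Axiomatized logics -/

theorem isNormalLogic_Ksys (Γ : Set ModalFormula) : IsNormalLogic (Ksys Γ) where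
  taut φ h := fun _ hL => hL.1.taut φ h
  axiomK φ ψ := fun _ hL => hL.1.axiomK φ ψ
  mp φ ψ h1 h2 := fun L hL => hL.1.mp φ ψ (h1 L hL) (h2 L hL)
  nec φ h := fun L hL => hL.1.nec φ (h L hL)
  subst φ s h := fun L hL => hL.1.subst φ s (h L hL)

theorem subset_Ksys (Γ : Set ModalFormula) : Γ ⊆ Ksys Γ :=
  fun _ h _ hL => hL.2 h

theorem Ksys_subset {Γ L : Set ModalFormula} (hL : IsNormalLogic L) (h : Γ ⊆ L) : Ksys Γ ⊆ L :=
  fun _ hφ => hφ L ⟨hL, h⟩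

theorem Ksys_singleton_congr {φ ψ : ModalFormula}
    (h : ∀ L, IsNormalLogic L → (φ ∈ L ↔ ψ ∈ L)) : Ksys {φ} = Ksys {ψ} := by
  refine Set.Subset.antisymm (Ksys_subset (isNormalLogic_Ksys _) ?_)
    (Ksys_subset (isNormalLogic_Ksys _) ?_)
  · rw [Set.singleton_subset_iff, h _ (isNormalLogic_Ksys _)]
    exact subset_Ksys _ rfl
  · rw [Set.singleton_subset_iff, ← h _ (isNormalLogic_Ksys _)]
    exact subset_Ksys _ rfl

theorem axiomSK_position_coords {v a : ℕ} {b : ℤ} {x : WithTop ℕ} {y : WithTop ℤ}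
    (hp : position v a b = (x, y)) : x.untopD (2 ^ v - 1) = a ∧ y.untopD (2 ^ v - 1) = b := by
  have hn : ((2 ^ v : ℕ) : ℤ) = 2 ^ v := by push_cast; rfl
  have hn' : 0 < 2 ^ v := by positivity
  simp only [position, Prod.mk.injEq] at hp
  obtain ⟨rfl, rfl⟩ := hp
  constructor
  · split_ifs with h
    · rw [WithTop.untopD_top]
      omega
    · exact WithTop.untopD_coe _ _
  · split_ifs with h
    · rw [WithTop.untopD_top, h]
    · exact WithTop.untopD_coe _ _

theorem exists_firstContext_coords {v a : ℕ} {b : ℤ} {x : WithTop ℕ} {y : WithTop ℤ}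
    (hc : InContext v a b) (hp : position v a b = (x, y)) :
    InContext (firstContext x y) (x.untopD (2 ^ firstContext x y - 1))
        (y.untopD (2 ^ firstContext x y - 1)) ∧
      position (firstContext x y) (x.untopD (2 ^ firstContext x y - 1))
        (y.untopD (2 ^ firstContext x y - 1)) = (x, y) := by
  obtain ⟨a', b', hc', hp'⟩ : firstContext x y ∈
      {v : ℕ | ∃ (a : ℕ) (b : ℤ), InContext v a b ∧ position v a b = (x, y)} :=
    Nat.sInf_mem ⟨v, a, b, hc, hp⟩
  obtain ⟨h1, h2⟩ := axiomSK_position_coords hp'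
  rw [h1, h2]
  exact ⟨hc', hp'⟩

theorem Ksys_axiomSK_eq {v a : ℕ} {b : ℤ} {x : WithTop ℕ} {y : WithTop ℤ}
    (hc : InContext v a b) (hp : position v a b = (x, y)) : Ksys {axiomSK v a b} = SK x y := by
  obtain ⟨hc', hp'⟩ := exists_firstContext_coords hc hp
  refine Ksys_singleton_congr fun L hL => ?_
  rw [axiomSK_mem_iff_boundedBy hL hc hp, axiomSK_mem_iff_boundedBy hL hc' hp']

theorem Ksys_axiomSD_eq {v a : ℕ} {b : ℤ} {x : WithTop ℕ} {y : WithTop ℤ}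
    (hc : InContext v a b) (hp : position v a b = (x, y)) : Ksys {axiomSD v a b} = SD x y := by
  obtain ⟨hc', hp'⟩ := exists_firstContext_coords hc hp
  refine Ksys_singleton_congr fun L hL => ?_
  rw [axiomSD, axiomSD, conj_mem_iff hL, conj_mem_iff hL, axiomSK_mem_iff_boundedBy hL hc hp,
    axiomSK_mem_iff_boundedBy hL hc' hp']

theorem IsPosition.exists_context {x : WithTop ℕ} {y : WithTop ℤ} (h : IsPosition x y) :
    ∃ (v a : ℕ) (b : ℤ), InContext v a b ∧ position v a b = (x, y) := by
  obtain ⟨h1, h2⟩ := h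
  induction y using WithTop.recTopCoe with
  | top =>
    induction x using WithTop.recTopCoe with
    -- Without variables n - 1 = 0, so (0, 0) already has position (*, *).
    | top => exact ⟨0, 0, 0, by simp [InContext], by simp [position]⟩
    | coe k =>
      have hk : k + 1 < 2 ^ (k + 1) := Nat.lt_two_pow_self
      have hk' : ((k + 1 : ℕ) : ℤ) < 2 ^ (k + 1) := by exact_mod_cast hk
      refine ⟨k + 1, k, 2 ^ (k + 1) - 1, by refine ⟨?_, ?_, ?_, ?_⟩ <;> omega, ?_⟩
      simp only [position, and_true, if_true]
      rw [if_neg (by omega)]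
      rfl
  | coe j =>
    have h1' : -1 ≤ j := by exact_mod_cast h1
    induction x using WithTop.recTopCoe with
    | top => exact absurd h2 (by simp [WithTop.map_top, ← WithTop.coe_one, ← WithTop.coe_add])
    | coe k =>
      have h2' : (k : ℤ) ≤ j + 1 := by
        rw [WithTop.map_coe] at h2
        exact_mod_cast h2
      have hk : (j + 1).toNat < 2 ^ (j + 1).toNat := Nat.lt_two_pow_self
      have hk' : (((j + 1).toNat : ℕ) : ℤ) < 2 ^ (j + 1).toNat := by exact_mod_cast hk
      -- With j + 1 variables, j + 1 < n gives j ≤ n - 2, so neither coordinate becomes `*`.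
      refine ⟨(j + 1).toNat, k, j, by refine ⟨?_, ?_, ?_, ?_⟩ <;> omega, ?_⟩
      simp only [position]
      rw [if_neg (by omega), if_neg (by omega)]
      rfl

/-! ### Degrees -/

theorem degree_neg (φ : ModalFormula) : degree (neg φ) = degree φ := by
  simp [neg, degree]

theorem degree_disj_le {φ ψ : ModalFormula} {d : ℕ} (h1 : degree φ ≤ d) (h2 : degree ψ ≤ d) :
    degree (disj φ ψ) ≤ d := by
  simp [disj, degree, degree_neg, h1, h2]

theorem degree_conj_le {φ ψ : ModalFormula} {d : ℕ} (h1 : degree φ ≤ d) (h2 : degree ψ ≤ d) :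
    degree (conj φ ψ) ≤ d := by
  simp [conj, degree, degree_neg, h1, h2]

theorem degree_withState (b : Bool) (φ : ModalFormula) : degree (withState b φ) = degree φ := by
  cases b <;> simp [withState, degree_neg]

theorem degree_bigConj_le {ι : Type} (s : Finset ι) {f : ι → ModalFormula} {d : ℕ}
    (h : ∀ i, degree (f i) ≤ d) : degree (bigConj s f) ≤ d := by
  rw [bigConj]
  induction s.toList with
  | nil => simp [top, degree, neg]
  | cons a l ih => exact degree_conj_le (h a) ih

theorem degree_bigDisj_le {ι : Type} (s : Finset ι) {f : ι → ModalFormula} {d : ℕ}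
    (h : ∀ i, degree (f i) ≤ d) : degree (bigDisj s f) ≤ d := by
  rw [bigDisj]
  induction s.toList with
  | nil => simp [degree]
  | cons a l ih => exact degree_disj_le (h a) ih

theorem degree_boolMinterm (v : ℕ) (t : Fin v → Bool) : degree (boolMinterm v t) = 0 :=
  Nat.le_zero.1 (degree_bigConj_le _ fun i => by simp [degree_withState, degree])

theorem degree_modalMinterm_le (v : ℕ) (ε : (Fin v → Bool) → Bool) :
    degree (modalMinterm v ε) ≤ 1 :=
  degree_conj_le (by simp [posMinterm, degree_boolMinterm]) (degree_bigConj_le _ fun t => by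
    simp [degree_withState, dia, degree_neg, degree, degree_boolMinterm])

theorem nonIterative_axiomSK (v x : ℕ) (y : ℤ) : NonIterative (axiomSK v x y) := by
  simp only [NonIterative, axiomSK, degree, max_le_iff]
  exact ⟨by simp [posMinterm, degree_boolMinterm], degree_disj_le
    (degree_bigDisj_le _ (degree_modalMinterm_le v)) (degree_bigDisj_le _ (degree_modalMinterm_le v))⟩

theorem nonIterative_axiomSD (v x : ℕ) (y : ℤ) : NonIterative (axiomSD v x y) :=
  degree_conj_le (by simp [dia, top, degree_neg, degree]) (nonIterative_axiomSK v x y)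

/-! ### The classification -/

/-- The supremum of `P`, with value 0 when `P` is empty; this is why the second clause needs 1 ≤ k.
-/
theorem exists_withTop_bound (P : ℕ → Prop) : ∃ x : WithTop ℕ, (∀ k, P k → (k : WithTop ℕ) ≤ x) ∧
    ∀ k : ℕ, 1 ≤ k → (k : WithTop ℕ) ≤ x → ∃ j, k ≤ j ∧ P j := by
  classical
  by_cases h : ∃ N, ∀ k, P k → k ≤ N
  · refine ⟨(Nat.find h : ℕ), fun k hk => Nat.cast_le.2 (Nat.find_spec h k hk), fun k hk hkx => ?_⟩
    by_contra hcon
    have : Nat.find h ≤ k - 1 := Nat.find_min' h fun j hj => by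
      by_contra hjk
      exact hcon ⟨j, by omega, hj⟩
    have := Nat.cast_le.1 hkx
    omega
  · push Not at h
    refine ⟨⊤, fun k _ => le_top, fun k _ _ => ?_⟩
    obtain ⟨j, hj, hj'⟩ := h k
    exact ⟨j, hj'.le, hj⟩

/-- The position of a normal logic. -/
theorem exists_position {L : Set ModalFormula} (hL : IsNormalLogic L) :
    ∃ (x : WithTop ℕ) (y : WithTop ℤ), IsPosition x y ∧ BoundedBy L x y ∧
      ∀ S, IsNormalLogic S → BoundedBy S x y → ∀ v ε, Excluded L v ε →
        ε = (fun _ => false) ∨ Excluded S v ε := by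
  -- The thresholds are the suprema of the counts of the minterms that `L` does not exclude: `x` for
  -- the irreflexive ones, `z` for the reflexive ones, with y = z - 1.
  obtain ⟨x, hx, hx'⟩ := exists_withTop_bound fun k => ∃ (v : ℕ) (ε : (Fin v → Bool) → Bool),
    ε (fun _ => true) = false ∧ countTrue v ε = k ∧ ¬ Excluded L v ε
  obtain ⟨z, hz, hz'⟩ := exists_withTop_bound fun k => ∃ (v : ℕ) (ε : (Fin v → Bool) → Bool),
    ε (fun _ => true) = true ∧ countTrue v ε = k ∧ ¬ Excluded L v ε
  obtain ⟨y, hy0, hy⟩ : ∃ y : WithTop ℤ, ((-1 : ℤ) : WithTop ℤ) ≤ y ∧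
      y + 1 = z.map (fun k : ℕ => (k : ℤ)) := by
    induction z using WithTop.recTopCoe with
    | top => exact ⟨⊤, le_top, by simp⟩
    | coe k =>
      refine ⟨((k - 1 : ℤ) : WithTop ℤ), WithTop.coe_le_coe.2 (by omega), ?_⟩
      rw [WithTop.map_coe, ← WithTop.coe_one, ← WithTop.coe_add]
      simp
  have hmap : ∀ k : ℕ, y + 1 < ((k : ℤ) : WithTop ℤ) ↔ z < (k : WithTop ℕ) := by
    intro k
    rw [hy]
    induction z using WithTop.recTopCoe with
    | top => simp
    | coe m =>
      rw [WithTop.map_coe, WithTop.coe_lt_coe]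
      exact Nat.cast_lt.trans (Nat.cast_lt (α := WithTop ℕ)).symm
  -- If an irreflexive minterm of count j ≥ 1 is not excluded, neither is a reflexive one of the
  -- same count. Count 0 is left out, since reflexive minterms are nonempty.
  have hxz : ∀ k : ℕ, 1 ≤ k → (k : WithTop ℕ) ≤ x → (k : WithTop ℕ) ≤ z := by
    intro k hk hkx
    obtain ⟨j, hj, v, ε, hT, hc, hn⟩ := hx' k hk hkx
    obtain ⟨δ, hδ, hδ'⟩ := exists_countTrue_of_reflexive (v := v) (k := j) (by omega)
      (hc ▸ countTrue_le ε)
    refine le_trans (Nat.cast_le.2 hj) (hz j ⟨v, δ, hδ, hδ', fun hex => hn ?_⟩)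
    exact hex.of_card hL (by omega) (by omega) (by simp [hT])
  refine ⟨x, y, ⟨hy0, ?_⟩, fun v ε => ⟨fun hT hlt => ?_, fun hT hlt => ?_⟩, ?_⟩
  · rw [hy]
    induction z using WithTop.recTopCoe with
    | top => simp
    | coe m =>
      have hxm : x ≤ (m : WithTop ℕ) := by
        by_contra hcon
        have h1 : ((m + 1 : ℕ) : WithTop ℕ) ≤ x := by
          induction x using WithTop.recTopCoe with
          | top => exact le_top
          | coe k => exact Nat.cast_le.2 (Nat.cast_lt.1 (not_le.1 hcon))
        have := Nat.cast_le.1 (hxz (m + 1) (by omega) h1)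
        omega
      induction x using WithTop.recTopCoe with
      | top => exact absurd hxm (by simp)
      | coe k =>
        rw [WithTop.map_coe, WithTop.map_coe, WithTop.coe_le_coe]
        exact Nat.cast_le.2 (Nat.cast_le.1 hxm)
  · by_contra hn
    exact absurd (hx _ ⟨v, ε, hT, rfl, hn⟩) (not_le.2 hlt)
  · by_contra hn
    exact absurd (hz _ ⟨v, ε, hT, rfl, hn⟩) (not_le.2 ((hmap _).1 hlt))
  -- If `S` does not exclude a nonempty ε, its count is within the threshold, so `L` fails to
  -- exclude some minterm of the same kind and at least that count; but excluding ε would exclude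
  -- that one too.
  · intro S hS hb v ε hex
    by_contra! hcon
    have hpos : 1 ≤ countTrue v ε := by
      by_contra h0
      exact hcon.1 (eq_const_false_of_countTrue (by omega))
    cases hT : ε (fun _ => true) with
    | false =>
      have hle : (countTrue v ε : WithTop ℕ) ≤ x := not_lt.1 fun hlt => hcon.2 ((hb v ε).1 hT hlt)
      obtain ⟨j, hj, w, δ, hδ, hδ', hn⟩ := hx' _ hpos hle
      exact hn (hex.of_card hL (by omega) (by omega) (by simp [hδ]))
    | true =>
      have hle : (countTrue v ε : WithTop ℕ) ≤ z :=
        not_lt.1 fun hlt => hcon.2 ((hb v ε).2 hT ((hmap _).2 hlt))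
      obtain ⟨j, hj, w, δ, hδ, hδ', hn⟩ := hz' _ hpos hle
      exact hn (hex.of_card hL (by omega) (by omega) (by simp [hT]))

theorem NonIterativeLogic.exists_eq {L : Set ModalFormula} (h : NonIterativeLogic L) :
    ∃ (x : WithTop ℕ) (y : WithTop ℤ), IsPosition x y ∧ (L = SK x y ∨ L = SD x y) := by
  obtain ⟨Γ, hΓ, rfl⟩ := h
  have hL := isNormalLogic_Ksys Γ
  obtain ⟨x, y, hxy, hb, hex⟩ := exists_position hL
  obtain ⟨v, a, b, hc, hp⟩ := hxy.exists_context
  refine ⟨x, y, hxy, ?_⟩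
  rw [← Ksys_axiomSK_eq hc hp, ← Ksys_axiomSD_eq hc hp]
  have hK : axiomSK v a b ∈ Ksys Γ := (axiomSK_mem_iff_boundedBy hL hc hp).2 hb
  -- The thresholds say nothing about the empty minterm, whose exclusion is equivalent to ◇⊤ being a
  -- theorem.
  by_cases hD : dia top ∈ Ksys Γ
  · right
    have hS := isNormalLogic_Ksys {axiomSD v a b}
    obtain ⟨hS1, hS2⟩ := (conj_mem_iff hS).1 (subset_Ksys {axiomSD v a b} rfl)
    refine Set.Subset.antisymm (Ksys_subset hS fun γ hγ => ?_)
      (Ksys_subset hL (Set.singleton_subset_iff.2 ((conj_mem_iff hL).2 ⟨hD, hK⟩)))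
    refine mem_of_excluded_imp hL hS (fun w ε hε => ?_) (hΓ γ hγ) (subset_Ksys Γ hγ)
    rcases hex _ hS ((axiomSK_mem_iff_boundedBy hS hc hp).1 hS2) w ε hε with rfl | h
    · exact (excluded_const_false_iff hS).2 hS1
    · exact h
  · left
    have hS := isNormalLogic_Ksys {axiomSK v a b}
    refine Set.Subset.antisymm (Ksys_subset hS fun γ hγ => ?_)
      (Ksys_subset hL (Set.singleton_subset_iff.2 hK))
    refine mem_of_excluded_imp hL hS (fun w ε hε => ?_) (hΓ γ hγ) (subset_Ksys Γ hγ)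
    rcases hex _ hS ((axiomSK_mem_iff_boundedBy hS hc hp).1 (subset_Ksys _ rfl)) w ε hε with rfl | h
    · exact absurd ((excluded_const_false_iff hL).1 hε) hD
    · exact h

theorem finitelyAxiomatizable_SK (x : WithTop ℕ) (y : WithTop ℤ) : FinitelyAxiomatizable (SK x y) :=
  ⟨_, Set.finite_singleton _, rfl⟩

theorem finitelyAxiomatizable_SD (x : WithTop ℕ) (y : WithTop ℤ) : FinitelyAxiomatizable (SD x y) :=
  ⟨_, Set.finite_singleton _, rfl⟩

/-- (1) A normal logic that is not finitely axiomatizable has no axiomatization by non-iterative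
formulas (the set of all formulas being countable, every set of axioms is countable).
(2) The non-iterative normal logics are exactly the systems `S_K(x, y)` and `S_D(x, y)`.
(3) These systems are finitely axiomatizable, and (4) they are what the axioms of every context
in which the position occurs axiomatize. -/
theorem corollary12 :
    (∀ S : Set ModalFormula, IsNormalLogic S → ¬ FinitelyAxiomatizable S →
      ¬ ∃ Γ : Set ModalFormula, (∀ φ ∈ Γ, NonIterative φ) ∧ S = Ksys Γ) ∧
    (∀ S : Set ModalFormula, IsNormalLogic S →
      (NonIterativeLogic S ↔
        ∃ (x : WithTop ℕ) (y : WithTop ℤ), IsPosition x y ∧ (S = SK x y ∨ S = SD x y))) ∧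
    (∀ (x : WithTop ℕ) (y : WithTop ℤ), IsPosition x y →
      FinitelyAxiomatizable (SK x y) ∧ FinitelyAxiomatizable (SD x y)) ∧
    (∀ (v a : ℕ) (b : ℤ) (x : WithTop ℕ) (y : WithTop ℤ),
      InContext v a b → position v a b = (x, y) →
        Ksys {axiomSK v a b} = SK x y ∧ Ksys {axiomSD v a b} = SD x y) := by
  refine ⟨fun S _ hS hΓ => ?_, fun S _ => ⟨fun h => h.exists_eq, ?_⟩, fun x y _ =>
    ⟨finitelyAxiomatizable_SK x y, finitelyAxiomatizable_SD x y⟩, fun v a b x y hc hp =>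
    ⟨Ksys_axiomSK_eq hc hp, Ksys_axiomSD_eq hc hp⟩⟩
  · obtain ⟨x, y, -, rfl | rfl⟩ := NonIterativeLogic.exists_eq hΓ
    · exact hS (finitelyAxiomatizable_SK x y)
    · exact hS (finitelyAxiomatizable_SD x y)
  · rintro ⟨x, y, -, rfl | rfl⟩
    · exact ⟨_, by rintro _ rfl; exact nonIterative_axiomSK _ _ _, rfl⟩
    · exact ⟨_, by rintro _ rfl; exact nonIterative_axiomSD _ _ _, rfl⟩
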